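/- Let $\mathcal X,\mathcal Y$ be finite alphabets and $P_{Y|X}$ a stochastic matrix from $\mathcal X$ to $\mathcal Y$, possibly with zero entries (so the case $C_1=\max_{a,a'}D(P_{Y|X=a}\|P_{Y|X=a'})=\infty$ is included), extended memorylessly by $P_{Y^n|X^n}(y^n|x^n)=\prod_{j=1}^n P_{Y|X}(y_j|x_j)$. Consider the channel either without input constraint, in which case all words $x^n\in\mathcal X^n$ and all input distributions $P_X$ on $\mathcal X$ are admissible, or with an input constraint $(\mathtt c,P)$, $\mathtt c\colon\mathcal X\to\mathbb R$, $P\in\mathbb R$, in which case the admissible words are those with $\sum_{j=1}^n \mathtt c(x_j)\le nP$ and the admissible input distributions are those with $\mathbb E[\mathtt c(X)]\le P$. Let $C=\max I(X;Y)$ over the admissible $P_X$, let $P_Y^*$ be the output distribution of a maximizing $P_X$ (the capacity-achieving output distribution), and let $P^*_{Y^n}=(P_Y^*)^{n}$ be its $n$-fold product. Assume $C>0$ and let $0\le\epsilon<1$. An $(n,M,\epsilon)_{max,det}$ code ($M\ge1$) consists of admissible codewords $c_1,\dots,c_M\in\mathcal X^n$ (not necessarily distinct) and a possibly randomized decoder,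 a transition kernel from $\mathcal Y^n$ to $\{1,\dots,M\}$, such that for every $j\in\{1,\dots,M\}$ the decoder outputs a message other than $j$ with probability at most $\epsilon$ when $c_j$ is sent. Its output distribution is $P_{Y^n}=\frac1M\sum_{j=1}^M P_{Y^n|X^n=c_j}$. Logarithms are natural and $D(\cdot\|\cdot)$ denotes relative entropy. Then there is a constant $b>0$, depending only on the channel, the constraint and $\epsilon$, such that for every $n\ge2$, every $M$ and every $(n,M,\epsilon)_{max,det}$ code $$ D(P_{Y^n}\,\|\,P^*_{Y^n})\le nC-\log M+b\sqrt n\,\log^{3/2}n . $$ In particular, for every sequence of $(n,M_n,\epsilon)_{max,det}$ codes, $n=1,2,\dots$, with $\frac1n\log M_n\to C$ one has $$ \frac1n D(P_{Y^n}\,\|\,P^*_{Y^n})\to0 . $$ -/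

import Mathlib

open MeasureTheory ProbabilityTheory InformationTheory Filter Topology
open scoped ENNReal NNReal

namespace DMC

noncomputable section

/-- An input cost constraint on the alphabet `X`: `none` means that there is no constraint,
`some (c, P)` is the constraint with cost function `c` and budget `P`. -/
abbrev InputConstraint (X : Type*) := Option ((X → ℝ) × ℝ)

variable {X Y : Type*} [MeasurableSpace X] [MeasurableSpace Y]

/-- The words that may be sent at blocklength `n`: all of `X ^ n` without constraint, and
the words with `∑ j, c (x j) ≤ n * P` under the constraint `(c, P)`. -/
def inputSpace {X : Type*} (κ : InputConstraint X) (n : ℕ) : Set (Fin n → X) :=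
  match κ with
  | none => Set.univ
  | some (c, P) => {x | ∑ j, c (x j) ≤ n * P}

/-- The single-letter input distributions over which the mutual information is maximized: all
probability measures without constraint, and those with `E[c(X)] ≤ P` under `(c, P)`. -/
def inputLaws (κ : InputConstraint X) : Set (ProbabilityMeasure X) :=
  match κ with
  | none => Set.univ
  | some (c, P) => {p | ∫ x, c x ∂(p : Measure X) ≤ P}

/-- Mutual information `I(X; Y) = D(P_{XY} ‖ P_X × P_Y)`, in nats, for the input law `p` and
the random transformation `W`. -/
def mutualInfo (W : Kernel X Y) (p : ProbabilityMeasure X) : ℝ≥0∞ :=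
  klDiv ((p : Measure X) ⊗ₘ W) ((p : Measure X).prod (W ∘ₘ (p : Measure X)))

/-- The capacity `C`, in nats: the supremum of the mutual information over the admissible input
laws. For finite alphabets this supremum is finite. -/
def capacity (W : Kernel X Y) (κ : InputConstraint X) : ℝ :=
  (⨆ p ∈ inputLaws κ, mutualInfo W p).toReal

/-- `Q` is a capacity-achieving output distribution: the output law of an admissible input law
that maximizes the mutual information. -/
def IsCaod (W : Kernel X Y) (κ : InputConstraint X) (Q : Measure Y) : Prop :=
  ∃ p ∈ inputLaws κ, (∀ p' ∈ inputLaws κ, mutualInfo W p' ≤ mutualInfo W p) ∧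
    Q = W ∘ₘ (p : Measure X)

/-- `P_{Y^n | X^n = x}`, the memoryless extension of `W` evaluated at the word `x`. -/
def wordLaw (W : Kernel X Y) {n : ℕ} (x : Fin n → X) : Measure (Fin n → Y) :=
  Measure.pi fun j => W (x j)

/-- An `(n, M, ε)` code for the memoryless channel `W`, with maximal error probability at most
`ε`, a deterministic encoder, and a decoder that may be randomized. -/
structure MaxDetCode (W : Kernel X Y) (κ : InputConstraint X) (n M : ℕ) (ε : ℝ) where
  /-- there is at least one message -/
  pos : 0 < M
  /-- the encoder -/
  enc : Fin M → Fin n → X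
  /-- codewords are admissible channel inputs -/
  enc_mem : ∀ i, enc i ∈ inputSpace κ n
  /-- the decoder, a random transformation -/
  dec : Kernel (Fin n → Y) (Fin M)
  /-- the decoder outputs a probability distribution on the messages -/
  isMarkovKernel_dec : IsMarkovKernel dec
  /-- for every message `i`, the decoded message differs from `i` with probability at most `ε`
  when `i` is sent -/
  error_le : ∀ i, (dec ∘ₘ wordLaw W (enc i)) {i}ᶜ ≤ ENNReal.ofReal ε

/-- `P_{Y^n}`, the output distribution induced by equiprobable messages. -/
def MaxDetCode.outputLaw {W : Kernel X Y} {κ : InputConstraint X} {n M : ℕ} {ε : ℝ}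
    (𝒞 : MaxDetCode W κ n M ε) : Measure (Fin n → Y) :=
  (M : ℝ≥0∞)⁻¹ • ∑ i, wordLaw W (𝒞.enc i)

/-- `P*_{Y^n}`, the `n`-th power of the single-letter distribution `Q`. -/
def powerLaw (Q : Measure Y) (n : ℕ) : Measure (Fin n → Y) :=
  Measure.pi fun _ => Q

end

end DMC

/-! Let `P_i` be the output law of codeword `i` and `P̄` their average. The compensation identity
says that `D(P̄ ‖ Qⁿ)` equals the average of `D(P_i ‖ Qⁿ)` minus the average of `D(P_i ‖ P̄)`, the
latter being the mutual information between a uniform message and the output. It remains to bound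
the first average above by `nC` and the second below by `log M - O(√n log^{3/2} n)`.

Upper bound: `Q` comes from a maximizer of the concave functional `I(X; Y)`, so the directional
derivative towards any admissible input law `r` is nonpositive, which gives `D(W ‖ Q | r) ≤ C`
(`IsCaod.sum_mul_log_div_le`). The empirical law of an admissible word is an admissible `r`, and
divergence from a product law is additive (`IsCaod.sum_word_le`).

Lower bound: Fano's inequality alone loses a constant fraction of `log M` when `ε > 0`. Enlarging
each decoding set to its Hamming `l`-neighbourhood with `l` of order `√(n log n)` raises the
probability of success to `1 - O(1/n)` (`sum_compl_blowup_le`), while each output lies in at most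
`(n|Y|)^l · 2/(1-ε)` of the enlarged sets. Fano's inequality for lists (`log_le_average_klDiv`) then
loses only about `l log n`.

Log-likelihood ratios enter only through expectations, so zero entries of the channel do no harm:
`P_i ≪ Qⁿ` suffices, and optimality of `Q` provides it. -/

namespace DMC

/-! ### Concentration on product spaces and blowing-up -/

section Concentration

variable {Y : Type*} [Fintype Y]

/-- Hoeffding's lemma: `h` stays within 1 of its mean, so the chord of the exponential over `[-1,
1]` bounds the integrand. The linear term averages to zero, leaving `cosh s ≤ exp (s² / 2)`. -/
lemma sum_mul_exp_le_exp {w : Y → ℝ} (hw : w ∈ stdSimplex ℝ Y) {h : Y → ℝ}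
    (hosc : ∀ a b, |h a - h b| ≤ 1) (s : ℝ) :
    ∑ a, w a * Real.exp (s * h a) ≤ Real.exp (s * ∑ a, w a * h a + s ^ 2 / 2) := by
  set m := ∑ a, w a * h a with hm
  have hdev (a : Y) : |h a - m| ≤ 1 := by
    have : h a - m = ∑ b, w b * (h a - h b) := by
      simp_rw [mul_sub, Finset.sum_sub_distrib, ← Finset.sum_mul, hw.2, one_mul, hm]
    rw [this]
    calc |∑ b, w b * (h a - h b)| ≤ ∑ b, |w b * (h a - h b)| := Finset.abs_sum_le_sum_abs _ _
      _ ≤ ∑ b, w b := Finset.sum_le_sum fun b _ => by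
          rw [abs_mul, abs_of_nonneg (hw.1 b)]
          exact mul_le_of_le_one_right (hw.1 b) (hosc a b)
      _ = 1 := hw.2
  calc ∑ a, w a * Real.exp (s * h a)
      ≤ ∑ a, w a * (Real.exp (s * m) * (Real.cosh s + (h a - m) * Real.sinh s)) := by
        refine Finset.sum_le_sum fun a _ => mul_le_mul_of_nonneg_left ?_ (hw.1 a)
        have := Real.exp_mul_le_cosh_add_mul_sinh (hdev a) s
        calc Real.exp (s * h a) = Real.exp (s * m) * Real.exp ((h a - m) * s) := by
              rw [← Real.exp_add]; ring_nf
          _ ≤ _ := mul_le_mul_of_nonneg_left (by simpa [mul_comm] using this) (Real.exp_nonneg _)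
    _ = Real.exp (s * m) * ((∑ a, w a) * Real.cosh s
          + (∑ a, w a * h a - (∑ a, w a) * m) * Real.sinh s) := by
        simp only [Finset.sum_mul, mul_add, sub_mul, mul_sub, Finset.mul_sum,
          Finset.sum_add_distrib, Finset.sum_sub_distrib]
        congr 1
        · exact Finset.sum_congr rfl fun _ _ => by ring
        · congr 1 <;> exact Finset.sum_congr rfl fun _ _ => by ring
    _ = Real.exp (s * m) * Real.cosh s := by rw [hw.2, ← hm]; ring
    _ ≤ Real.exp (s * m) * Real.exp (s ^ 2 / 2) :=
        mul_le_mul_of_nonneg_left (Real.cosh_le_exp_half_sq s) (Real.exp_nonneg _)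
    _ = _ := (Real.exp_add _ _).symm

lemma sum_prod_mul_succ {n : ℕ} (w : Fin (n + 1) → Y → ℝ) (F : (Fin (n + 1) → Y) → ℝ) :
    ∑ y, (∏ j, w j (y j)) * F y =
      ∑ z : Fin n → Y, (∏ j, w j.succ (z j)) * ∑ a, w 0 a * F (Fin.cons a z) := by
  rw [← (Fin.consEquiv fun _ : Fin (n + 1) => Y).sum_comp, Fintype.sum_prod_type,
    Finset.sum_comm]
  refine Finset.sum_congr rfl fun z _ => ?_
  rw [Finset.mul_sum]
  refine Finset.sum_congr rfl fun a _ => ?_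
  change (∏ j, w j ((Fin.cons a z : Fin (n + 1) → Y) j)) * F (Fin.cons a z) = _
  rw [Fin.prod_univ_succ]
  simp only [Fin.cons_zero, Fin.cons_succ]
  ring

lemma prod_nonneg_of_stdSimplex {n : ℕ} {w : Fin n → Y → ℝ}
    (hw : ∀ j, w j ∈ stdSimplex ℝ Y) (y : Fin n → Y) : 0 ≤ ∏ j, w j (y j) :=
  Finset.prod_nonneg fun j _ => (hw j).1 (y j)

lemma sum_prod_eq_one {n : ℕ} {w : Fin n → Y → ℝ} (hw : ∀ j, w j ∈ stdSimplex ℝ Y) :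
    ∑ y : Fin n → Y, ∏ j, w j (y j) = 1 := by
  classical
  rw [← Fintype.piFinset_univ, ← Finset.prod_univ_sum]
  exact Finset.prod_eq_one fun j _ => (hw j).2

/-- McDiarmid's inequality for the moment generating function, on a finite product space. -/
lemma sum_prod_mul_exp_le_exp {n : ℕ} {w : Fin n → Y → ℝ} (hw : ∀ j, w j ∈ stdSimplex ℝ Y)
    {f : (Fin n → Y) → ℝ} (hf : ∀ y j a, |f (Function.update y j a) - f y| ≤ 1) (s : ℝ) :
    ∑ y, (∏ j, w j (y j)) * Real.exp (s * f y) ≤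
      Real.exp (s * ∑ y, (∏ j, w j (y j)) * f y + n * s ^ 2 / 2) := by
  induction n with
  | zero => simp
  | succ n ih =>
    rw [sum_prod_mul_succ w, sum_prod_mul_succ w]
    -- Averaging out the first coordinate preserves bounded differences, so the induction hypothesis
    -- applies to `G`; the first coordinate itself costs one factor `exp (s² / 2)`.
    set G : (Fin n → Y) → ℝ := fun z => ∑ a, w 0 a * f (Fin.cons a z) with hG
    have hGlip (z : Fin n → Y) (j : Fin n) (a : Y) :
        |G (Function.update z j a) - G z| ≤ 1 := by
      rw [hG]
      simp only [← Finset.sum_sub_distrib, ← mul_sub]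
      calc |∑ b, w 0 b * (f (Fin.cons b (Function.update z j a)) - f (Fin.cons b z))|
          ≤ ∑ b, |w 0 b * (f (Fin.cons b (Function.update z j a)) - f (Fin.cons b z))| :=
            Finset.abs_sum_le_sum_abs _ _
        _ ≤ ∑ b, w 0 b := Finset.sum_le_sum fun b _ => by
            rw [abs_mul, abs_of_nonneg ((hw 0).1 b), Fin.cons_update]
            exact mul_le_of_le_one_right ((hw 0).1 b) (hf _ _ _)
        _ = 1 := (hw 0).2
    calc ∑ z : Fin n → Y, (∏ j, w j.succ (z j)) * ∑ a, w 0 a * Real.exp (s * f (Fin.cons a z))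
        ≤ ∑ z : Fin n → Y, (∏ j, w j.succ (z j)) * (Real.exp (s * G z) * Real.exp (s ^ 2 / 2)) := by
          refine Finset.sum_le_sum fun z _ => mul_le_mul_of_nonneg_left ?_
            (prod_nonneg_of_stdSimplex (fun j => hw j.succ) z)
          rw [← Real.exp_add]
          refine sum_mul_exp_le_exp (hw 0) (fun a b => ?_) s
          simpa [Fin.update_cons_zero] using hf (Fin.cons b z) 0 a
      _ = (∑ z : Fin n → Y, (∏ j, w j.succ (z j)) * Real.exp (s * G z)) * Real.exp (s ^ 2 / 2) := by
          rw [Finset.sum_mul]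
          exact Finset.sum_congr rfl fun _ _ => by ring
      _ ≤ Real.exp (s * ∑ z : Fin n → Y, (∏ j, w j.succ (z j)) * G z + n * s ^ 2 / 2)
            * Real.exp (s ^ 2 / 2) :=
          mul_le_mul_of_nonneg_right (ih (fun j => hw j.succ) hGlip) (Real.exp_nonneg _)
      _ = _ := by
          rw [← Real.exp_add, hG]
          push_cast
          ring_nf

variable [DecidableEq Y]

/-- The `l`-neighbourhood of `A` in Hamming distance. -/
def blowup {n : ℕ} (A : Finset (Fin n → Y)) (l : ℕ) : Finset (Fin n → Y) :=
  Finset.univ.filter fun y => ∃ z ∈ A, hammingDist y z ≤ l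

lemma hammingDist_update_le {Y : Type*} [DecidableEq Y] {n : ℕ} (y : Fin n → Y) (j : Fin n) (a : Y) :
    hammingDist (Function.update y j a) y ≤ 1 := by
  unfold hammingDist
  refine (Finset.card_le_card (t := {j}) fun i hi => ?_).trans (by simp)
  by_contra h
  simp_all [Function.update_of_ne]

/-- The blowing-up lemma, in exponential form. -/
lemma sum_compl_blowup_le {n : ℕ} {w : Fin n → Y → ℝ} (hw : ∀ j, w j ∈ stdSimplex ℝ Y)
    {A : Finset (Fin n → Y)} {δ : ℝ} (hδ : 0 < δ) (hA : δ ≤ ∑ y ∈ A, ∏ j, w j (y j))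
    {s : ℝ} (hs : 0 ≤ s) (l : ℕ) :
    ∑ y ∈ (blowup A l)ᶜ, ∏ j, w j (y j) ≤ Real.exp (n * s ^ 2 - s * l) / δ := by
  have hne : A.Nonempty := by
    rw [Finset.nonempty_iff_ne_empty]
    rintro rfl
    simp only [Finset.sum_empty] at hA
    linarith
  -- The Hamming distance to `A` vanishes on `A`, exceeds `l` off the blow-up, and has differences
  -- bounded by 1.
  set d : (Fin n → Y) → ℕ := fun y => A.inf' hne (hammingDist y) with hd
  have hd_le (y : Fin n → Y) (j : Fin n) (a : Y) : d (Function.update y j a) ≤ d y + 1 := by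
    obtain ⟨z, hz, hzd⟩ := Finset.exists_mem_eq_inf' hne (hammingDist y)
    calc d (Function.update y j a) ≤ hammingDist (Function.update y j a) z :=
          Finset.inf'_le _ hz
      _ ≤ hammingDist (Function.update y j a) y + hammingDist y z := hammingDist_triangle _ _ _
      _ ≤ d y + 1 := by
          have := hammingDist_update_le y j a
          simp only [hd, hzd]
          omega
  have hlip (y : Fin n → Y) (j : Fin n) (a : Y) :
      |(d (Function.update y j a) : ℝ) - d y| ≤ 1 := by
    have h1 : (d (Function.update y j a) : ℝ) ≤ d y + 1 := by exact_mod_cast hd_le y j a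
    have h2 : (d y : ℝ) ≤ d (Function.update y j a) + 1 := by
      have := hd_le (Function.update y j a) j (y j)
      simp only [Function.update_idem, Function.update_eq_self] at this
      exact_mod_cast this
    rw [abs_le]
    constructor <;> linarith
  have hw0 := prod_nonneg_of_stdSimplex hw
  set m := ∑ y : Fin n → Y, (∏ j, w j (y j)) * (d y : ℝ) with hm
  -- The moment at `-s` is at least the mass of `A`, which keeps the mean distance `m` from being
  -- large.
  have hlow : δ ≤ Real.exp (-s * m + n * s ^ 2 / 2) := by
    calc δ ≤ ∑ y ∈ A, ∏ j, w j (y j) := hA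
      _ = ∑ y ∈ A, (∏ j, w j (y j)) * Real.exp (-s * d y) := by
          refine Finset.sum_congr rfl fun y hy => ?_
          have : d y = 0 := by
            have := Finset.inf'_le (hammingDist y) hy
            simpa [hd] using this
          simp [this]
      _ ≤ ∑ y, (∏ j, w j (y j)) * Real.exp (-s * d y) :=
          Finset.sum_le_univ_sum_of_nonneg fun y => mul_nonneg (hw0 y) (Real.exp_nonneg _)
      _ ≤ _ := by simpa using sum_prod_mul_exp_le_exp hw hlip (-s)
  have hup : (∑ y ∈ (blowup A l)ᶜ, ∏ j, w j (y j)) * Real.exp (s * l) ≤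
      Real.exp (s * m + n * s ^ 2 / 2) := by
    calc (∑ y ∈ (blowup A l)ᶜ, ∏ j, w j (y j)) * Real.exp (s * l)
        ≤ ∑ y ∈ (blowup A l)ᶜ, (∏ j, w j (y j)) * Real.exp (s * d y) := by
          rw [Finset.sum_mul]
          refine Finset.sum_le_sum fun y hy => mul_le_mul_of_nonneg_left ?_ (hw0 y)
          have hl : l ≤ d y := by
            simp only [blowup, Finset.mem_compl, Finset.mem_filter, Finset.mem_univ, true_and,
              not_exists, not_and, not_le] at hy
            exact Finset.le_inf' _ _ fun z hz => (hy z hz).le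
          gcongr
      _ ≤ ∑ y, (∏ j, w j (y j)) * Real.exp (s * d y) :=
          Finset.sum_le_univ_sum_of_nonneg fun y => mul_nonneg (hw0 y) (Real.exp_nonneg _)
      _ ≤ _ := sum_prod_mul_exp_le_exp hw hlip s
  have hS : 0 ≤ ∑ y ∈ (blowup A l)ᶜ, ∏ j, w j (y j) := Finset.sum_nonneg fun y _ => hw0 y
  rw [le_div_iff₀ hδ]
  -- In the product of the two moment bounds the unknown mean `m` cancels.
  calc (∑ y ∈ (blowup A l)ᶜ, ∏ j, w j (y j)) * δ
      = (∑ y ∈ (blowup A l)ᶜ, ∏ j, w j (y j)) * Real.exp (s * l) * δ * Real.exp (-(s * l)) := by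
        rw [Real.exp_neg]
        field_simp
    _ ≤ Real.exp (s * m + n * s ^ 2 / 2) * Real.exp (-s * m + n * s ^ 2 / 2)
          * Real.exp (-(s * l)) := by gcongr
    _ = Real.exp (n * s ^ 2 - s * l) := by
        rw [← Real.exp_add, ← Real.exp_add]
        ring_nf

/-- Each word of the ball of radius `l + 1` is a one-coordinate update of a word of the ball of
radius `l`, and there are `n |Y|` possible updates. -/
lemma card_hammingBall_le {n : ℕ} (hn : 0 < n) (y : Fin n → Y) (l : ℕ) :
    (Finset.univ.filter fun z => hammingDist y z ≤ l).card ≤ (n * Fintype.card Y) ^ l := by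
  induction l with
  | zero =>
    simp only [nonpos_iff_eq_zero, hammingDist_eq_zero, pow_zero]
    rw [Finset.filter_eq]
    simp
  | succ l ih =>
    have hsub : (Finset.univ.filter fun z => hammingDist y z ≤ l + 1) ⊆
        ((Finset.univ.filter fun z => hammingDist y z ≤ l) ×ˢ
          (Finset.univ : Finset (Fin n × Y))).image
            fun q => Function.update q.1 q.2.1 q.2.2 := by
      intro z hz
      simp only [Finset.mem_filter, Finset.mem_univ, true_and, Finset.mem_image,
        Finset.mem_product, and_true, Prod.exists] at hz ⊢
      by_cases hzy : ∃ j, y j ≠ z j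
      · obtain ⟨j, hj⟩ := hzy
        refine ⟨Function.update z j (y j), j, z j, ?_, by simp⟩
        suffices hammingDist y (Function.update z j (y j)) < hammingDist y z by omega
        refine Finset.card_lt_card ?_
        rw [Finset.ssubset_iff_of_subset]
        · exact ⟨j, by simpa using hj, by simp⟩
        · intro i hi
          rcases eq_or_ne i j with rfl | hij
          · simp at hi
          · simpa [Function.update_of_ne hij] using hi
      · push Not at hzy
        obtain rfl : y = z := funext hzy
        -- The centre is reached by a trivial update, which needs a coordinate to exist.
        exact ⟨y, ⟨0, hn⟩, y ⟨0, hn⟩, by simp, by simp⟩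
    calc _ ≤ _ := Finset.card_le_card hsub
      _ ≤ _ := Finset.card_image_le
      _ ≤ (n * Fintype.card Y) ^ l * (n * Fintype.card Y) := by
          rw [Finset.card_product]
          refine Nat.mul_le_mul ih ?_
          simp
      _ = _ := (pow_succ _ _).symm

end Concentration

/-! ### Fano's inequality for lists and its application to codes -/

section ListDecoding

/-- This is `1 - 1/z ≤ log z` at `z = p / r`. The second alternative admits points where both masses
vanish. -/
lemma sub_le_mul_log_div {p r : ℝ} (hp : 0 ≤ p) (hr : 0 < r ∨ p = 0 ∧ 0 ≤ r) :
    p - r ≤ p * Real.log (p / r) := by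
  rcases hp.eq_or_lt with rfl | hp
  · rcases hr with hr | hr <;> simp <;> linarith
  · have hr : 0 < r := hr.resolve_right fun h => hp.ne' h.1
    have := Real.one_sub_inv_le_log_of_pos (div_pos hp hr)
    calc p - r = p * (1 - (p / r)⁻¹) := by field_simp
      _ ≤ _ := mul_le_mul_of_nonneg_left this hp.le

variable {Ω : Type*} [Fintype Ω] {M : ℕ}

/-- Fano's inequality for list decoding: if every `P i` gives mass at least `1 - η` to `E i`, and
no point lies in more than `N` of the sets `E i`, then the mutual information between a uniform
message and the output is close to `log (M / N)`. -/
lemma log_le_average_klDiv [DecidableEq Ω] {P : Fin M → Ω → ℝ} (hP : ∀ i, P i ∈ stdSimplex ℝ Ω) (hM : 0 < M)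
    {Pbar : Ω → ℝ} (hPbar : ∀ y, Pbar y = (M : ℝ)⁻¹ * ∑ i, P i y)
    {E : Fin M → Finset Ω} {N : ℝ} (hN : 1 ≤ N)
    (hE : ∀ y, ((Finset.univ.filter fun i => y ∈ E i).card : ℝ) ≤ N)
    {η : ℝ} (hEP : ∀ i, 1 - η ≤ ∑ y ∈ E i, P i y) :
    Real.log M - Real.log N - η * Real.log M - Real.log 2 ≤
      (M : ℝ)⁻¹ * ∑ i, ∑ y, P i y * Real.log (P i y / Pbar y) := by
  have hM' : (0 : ℝ) < M := by exact_mod_cast hM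
  have hM1 : (1 : ℝ) ≤ M := by exact_mod_cast hM
  have hPbar0 (y : Ω) : 0 ≤ Pbar y := by
    rw [hPbar]
    exact mul_nonneg (by positivity) (Finset.sum_nonneg fun i _ => (hP i).1 y)
  have hPbar1 : ∑ y, Pbar y = 1 := by
    simp_rw [hPbar, ← Finset.mul_sum]
    rw [Finset.sum_comm]
    simp only [(hP _).2, Finset.sum_const, Finset.card_univ, Fintype.card_fin, nsmul_eq_mul]
    field_simp
  set L : ℝ := Real.log (M / N) with hL
  have hLeq : L = Real.log M - Real.log N := Real.log_div (by positivity) (by positivity)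
  have hlogN : 0 ≤ Real.log N := Real.log_nonneg hN
  have hlogM : 0 ≤ Real.log M := Real.log_nonneg hM1
  have hexpL : Real.exp L = M / N := Real.exp_log (by positivity)
  -- `P i` is compared with the tilted measure `P̄ (1 + 1_{E i} M / N) / 2`. On `E i` only the
  -- summand `M / N` is kept, off `E i` only the 1; the halving costs the `log 2`.
  have hpoint (i : Fin M) (y : Ω) :
      P i y - Pbar y * (1 + if y ∈ E i then M / N else 0) / 2 ≤
        P i y * Real.log (P i y / Pbar y) - (if y ∈ E i then P i y * L else 0)
          + P i y * Real.log 2 := by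
    rcases ((hP i).1 y).eq_or_lt with h0 | h0
    · rw [← h0]
      have : (0 : ℝ) ≤ if y ∈ E i then M / N else 0 := by split_ifs <;> positivity
      have := mul_nonneg (hPbar0 y) (by linarith : 0 ≤ 1 + if y ∈ E i then (M : ℝ) / N else 0)
      simp
      linarith
    · have hpos : 0 < Pbar y := by
        rw [hPbar]
        exact mul_pos (by positivity)
          (Finset.sum_pos' (fun j _ => (hP j).1 y) ⟨i, Finset.mem_univ _, h0⟩)
      by_cases hy : y ∈ E i
      · have h1 := sub_le_mul_log_div h0.le
          (Or.inl (by positivity : 0 < Pbar y * Real.exp L / 2))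
        rw [Real.log_div h0.ne' (by positivity), Real.log_div (by positivity) two_ne_zero,
          Real.log_mul hpos.ne' (by positivity), Real.log_exp, hexpL] at h1
        simp only [hy, if_true]
        rw [Real.log_div h0.ne' hpos.ne']
        nlinarith
      · have h1 := sub_le_mul_log_div h0.le (Or.inl (by positivity : 0 < Pbar y / 2))
        rw [Real.log_div h0.ne' (by positivity), Real.log_div (by positivity) two_ne_zero] at h1
        simp only [hy, if_false]
        rw [Real.log_div h0.ne' hpos.ne']
        linarith
  -- The tilted measures need not be subprobabilities one by one; the list bound makes their average
  -- over `i` one.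
  have hmass : ∑ i, ∑ y, Pbar y * (1 + if y ∈ E i then M / N else 0) / 2 ≤ M := by
    rw [Finset.sum_comm]
    calc ∑ y, ∑ i, Pbar y * (1 + if y ∈ E i then M / N else 0) / 2
        ≤ ∑ y, Pbar y * M := by
          refine Finset.sum_le_sum fun y _ => ?_
          rw [← Finset.sum_div, ← Finset.mul_sum, Finset.sum_add_distrib, ← Finset.sum_filter]
          simp only [Finset.sum_const, Finset.card_univ, Fintype.card_fin, nsmul_eq_mul, mul_one]
          have : ((Finset.univ.filter fun i => y ∈ E i).card : ℝ) * (M / N) ≤ M := by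
            rw [mul_div_assoc', div_le_iff₀ (by positivity), mul_comm]
            exact mul_le_mul_of_nonneg_left (hE y) hM'.le
          rw [mul_div_assoc]
          exact mul_le_mul_of_nonneg_left (by linarith) (hPbar0 y)
      _ = M := by rw [← Finset.sum_mul, hPbar1, one_mul]
  have hsum := Finset.sum_le_sum fun i (_ : i ∈ (Finset.univ : Finset (Fin M))) =>
    Finset.sum_le_sum fun y (_ : y ∈ (Finset.univ : Finset Ω)) => hpoint i y
  simp only [Finset.sum_sub_distrib, Finset.sum_add_distrib] at hsum
  simp only [← Finset.sum_mul, (hP _).2, Finset.sum_const, Finset.card_univ, Fintype.card_fin,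
    nsmul_eq_mul, mul_one, one_mul] at hsum
  have hcorrect : (M : ℝ) * (L - η * Real.log M) ≤
      ∑ i, ∑ y, (if y ∈ E i then P i y * L else 0) := by
    calc (M : ℝ) * (L - η * Real.log M) = ∑ _i : Fin M, (L - η * Real.log M) := by simp [mul_sub]
      _ ≤ _ := Finset.sum_le_sum fun i _ => by
        rw [← Finset.sum_filter, Finset.filter_mem_eq_inter, Finset.univ_inter,
          ← Finset.sum_mul]
        have hle : ∑ y ∈ E i, P i y ≤ 1 := by
          rw [← (hP i).2]
          exact Finset.sum_le_univ_sum_of_nonneg fun y => (hP i).1 y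
        -- Replacing `L` by `log M` on the missing mass avoids any case split on the sign of `L`.
        have h1 : (1 - ∑ y ∈ E i, P i y) * L ≤ (1 - ∑ y ∈ E i, P i y) * Real.log M :=
          mul_le_mul_of_nonneg_left (by linarith) (by linarith)
        have h2 : (1 - ∑ y ∈ E i, P i y) * Real.log M ≤ η * Real.log M :=
          mul_le_mul_of_nonneg_right (by linarith [hEP i]) hlogM
        linarith
  rw [inv_mul_eq_div, le_div_iff₀ hM']
  rw [← hLeq]
  nlinarith

/-- A crude bound on `M`, enough because `log M` is later multiplied by a failure probability of
order `1/n`. -/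
lemma card_mul_le_of_correct {P : Fin M → Ω → ℝ} (hP : ∀ i, P i ∈ stdSimplex ℝ Ω)
    {d : Ω → Fin M → ℝ} (hd : ∀ y, d y ∈ stdSimplex ℝ (Fin M)) {ε : ℝ}
    (hcorr : ∀ i, 1 - ε ≤ ∑ y, P i y * d y i) : M * (1 - ε) ≤ Fintype.card Ω := by
  calc M * (1 - ε) = ∑ _i : Fin M, (1 - ε) := by simp [mul_sub]
    _ ≤ ∑ i, ∑ y, P i y * d y i := Finset.sum_le_sum fun i _ => hcorr i
    _ ≤ ∑ i, ∑ y, d y i := by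
        refine Finset.sum_le_sum fun i _ => Finset.sum_le_sum fun y _ => ?_
        refine mul_le_of_le_one_left ((hd y).1 i) ?_
        rw [← (hP i).2]
        exact Finset.single_le_sum (fun z _ => (hP i).1 z) (Finset.mem_univ y)
    _ = Fintype.card Ω := by
        rw [Finset.sum_comm]
        simp [(hd _).2]

/-- A lower bound, for every blow-up radius, on the mutual information between a uniform message
and the output of a memoryless channel, for a code with a randomized decoder. -/
lemma log_le_average_klDiv_of_code {Y : Type*} [Fintype Y] {n : ℕ} (hn : 0 < n)
    {w : Fin M → Fin n → Y → ℝ} (hw : ∀ i j, w i j ∈ stdSimplex ℝ Y) (hM : 0 < M)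
    {d : (Fin n → Y) → Fin M → ℝ} (hd : ∀ y, d y ∈ stdSimplex ℝ (Fin M))
    {ε : ℝ} (hε0 : 0 ≤ ε) (hε1 : ε < 1)
    (hcorr : ∀ i, 1 - ε ≤ ∑ y, (∏ j, w i j (y j)) * d y i)
    {Pbar : (Fin n → Y) → ℝ} (hPbar : ∀ y, Pbar y = (M : ℝ)⁻¹ * ∑ i, ∏ j, w i j (y j))
    {s : ℝ} (hs : 0 ≤ s) (l : ℕ) :
    Real.log M - Real.log ((n * Fintype.card Y : ℝ) ^ l * (2 / (1 - ε)))
        - Real.exp (n * s ^ 2 - s * l) * (2 / (1 - ε)) * Real.log M - Real.log 2 ≤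
      (M : ℝ)⁻¹ * ∑ i, ∑ y, (∏ j, w i j (y j)) * Real.log ((∏ j, w i j (y j)) / Pbar y) := by
  classical
  have hε : 0 < 1 - ε := by linarith
  have hY : Nonempty Y := by
    by_contra h
    rw [not_nonempty_iff] at h
    have := (hw ⟨0, hM⟩ ⟨0, hn⟩).2
    simp at this
  have hcard : (1 : ℝ) ≤ n * Fintype.card Y := by
    exact_mod_cast Nat.mul_pos hn Fintype.card_pos
  -- Thresholding replaces the randomized decoder by lists: at half the success probability, `A i`
  -- still has mass at least `(1 - ε) / 2`, and no output lies in more than `2 / (1 - ε)` of the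
  -- sets.
  set A : Fin M → Finset (Fin n → Y) := fun i =>
    Finset.univ.filter fun y => (1 - ε) / 2 ≤ d y i with hA
  have hw0 (i : Fin M) := prod_nonneg_of_stdSimplex (hw i)
  have hw1 (i : Fin M) := sum_prod_eq_one (hw i)
  have hd1 (y : Fin n → Y) (i : Fin M) : d y i ≤ 1 := by
    rw [← (hd y).2]
    exact Finset.single_le_sum (fun z _ => (hd y).1 z) (Finset.mem_univ i)
  have hmass (i : Fin M) : (1 - ε) / 2 ≤ ∑ y ∈ A i, ∏ j, w i j (y j) := by
    have hle : ∑ y, (∏ j, w i j (y j)) * d y i ≤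
        ∑ y, ((if y ∈ A i then ∏ j, w i j (y j) else 0)
          + (∏ j, w i j (y j)) * ((1 - ε) / 2)) := by
      refine Finset.sum_le_sum fun y _ => ?_
      by_cases hy : y ∈ A i
      · have := mul_le_mul_of_nonneg_left (hd1 y i) (hw0 i y)
        have := mul_nonneg (hw0 i y) (by linarith : 0 ≤ (1 - ε) / 2)
        simp only [hy, if_true]
        linarith
      · have : d y i ≤ (1 - ε) / 2 := by
          simp only [hA, Finset.mem_filter, Finset.mem_univ, true_and, not_le] at hy
          exact hy.le
        simp only [hy, if_false, zero_add]
        exact mul_le_mul_of_nonneg_left this (hw0 i y)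
    rw [Finset.sum_add_distrib, ← Finset.sum_mul, hw1, ← Finset.sum_filter,
      Finset.filter_mem_eq_inter, Finset.univ_inter] at hle
    linarith [hcorr i]
  have hlist (z : Fin n → Y) :
      ((Finset.univ.filter fun i => z ∈ A i).card : ℝ) ≤ 2 / (1 - ε) := by
    rw [le_div_iff₀ hε]
    have : ((Finset.univ.filter fun i => z ∈ A i).card : ℝ) * ((1 - ε) / 2) ≤ 1 := by
      calc _ = ∑ i ∈ Finset.univ.filter fun i => z ∈ A i, (1 - ε) / 2 := by simp
        _ ≤ ∑ i ∈ Finset.univ.filter fun i => z ∈ A i, d z i :=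
            Finset.sum_le_sum fun i hi => by simpa [hA] using hi
        _ ≤ ∑ i, d z i := Finset.sum_le_univ_sum_of_nonneg fun i => (hd z).1 i
        _ = 1 := (hd z).2
    linarith
  refine log_le_average_klDiv (E := fun i => blowup (A i) l)
    (N := (n * Fintype.card Y : ℝ) ^ l * (2 / (1 - ε))) (fun i => ⟨hw0 i, hw1 i⟩) hM hPbar
    ?_ ?_ ?_
  · refine one_le_mul_of_one_le_of_one_le (one_le_pow₀ hcard) ?_
    rw [le_div_iff₀ hε]
    linarith
  · intro y
    -- Every message listed at `y` after the blow-up was listed at some point of the ball around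
    -- `y`.
    have hsub : (Finset.univ.filter fun i => y ∈ blowup (A i) l) ⊆
        (Finset.univ.filter fun z => hammingDist y z ≤ l).biUnion
          fun z => Finset.univ.filter fun i => z ∈ A i := by
      intro i hi
      simp only [blowup, Finset.mem_filter, Finset.mem_univ, true_and,
        Finset.mem_biUnion] at hi ⊢
      obtain ⟨z, hz, hl⟩ := hi
      exact ⟨z, hl, hz⟩
    calc ((Finset.univ.filter fun i => y ∈ blowup (A i) l).card : ℝ)
        ≤ ∑ z ∈ Finset.univ.filter fun z => hammingDist y z ≤ l,
            ((Finset.univ.filter fun i => z ∈ A i).card : ℝ) := by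
          exact_mod_cast (Finset.card_le_card hsub).trans Finset.card_biUnion_le
      _ ≤ ∑ z ∈ Finset.univ.filter fun z => hammingDist y z ≤ l, 2 / (1 - ε) :=
          Finset.sum_le_sum fun z _ => hlist z
      _ = (Finset.univ.filter fun z => hammingDist y z ≤ l).card * (2 / (1 - ε)) := by simp
      _ ≤ _ := by
          refine mul_le_mul_of_nonneg_right ?_ (by positivity)
          exact_mod_cast card_hammingBall_le hn y l
  · intro i
    have h1 := sum_compl_blowup_le (hw i) (by linarith) (hmass i) hs l
    have h2 := Finset.sum_add_sum_compl (blowup (A i) l) fun y => ∏ j, w i j (y j)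
    rw [hw1] at h2
    have h3 : Real.exp (n * s ^ 2 - s * l) / ((1 - ε) / 2) =
      Real.exp (n * s ^ 2 - s * l) * (2 / (1 - ε)) := by field_simp
    linarith

/-- With blow-up radius of order `√(n log n)`, the loss in the list-decoding bound is of order
`√n log^{3/2} n`. -/
lemma exists_forall_loss_le {K : ℕ} (hK : 0 < K) {ε : ℝ} (hε0 : 0 ≤ ε) (hε1 : ε < 1) :
    ∃ b : ℝ, 0 < b ∧ ∀ n : ℕ, 2 ≤ n → ∃ s : ℝ, 0 ≤ s ∧ ∃ l : ℕ, ∀ M : ℕ, 0 < M →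
      M * (1 - ε) ≤ (K : ℝ) ^ n →
      Real.log ((n * K : ℝ) ^ l * (2 / (1 - ε)))
        + Real.exp (n * s ^ 2 - s * l) * (2 / (1 - ε)) * Real.log M + Real.log 2 ≤
        b * √(n : ℝ) * Real.log n ^ (3 / 2 : ℝ) := by
  have hε : 0 < 1 - ε := by linarith
  set D : ℝ := 2 / (1 - ε) with hD
  have hD1 : 1 ≤ D := by rw [hD, le_div_iff₀ hε]; linarith
  set c : ℝ := Real.log K with hc
  have hc0 : 0 ≤ c := Real.log_nonneg (by exact_mod_cast hK)
  have hlogD : 0 ≤ Real.log D := Real.log_nonneg hD1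
  set R : ℝ := Real.log D + D * (c + Real.log D) + 1 with hR
  have hR0 : 0 ≤ R := by positivity
  refine ⟨4 * (1 + 2 * c) + 2 * R, by positivity, fun n hn => ?_⟩
  have hn0 : (0 : ℝ) < n := by positivity
  have hn2 : (2 : ℝ) ≤ n := by exact_mod_cast hn
  set x : ℝ := Real.log n with hx
  have hx2 : Real.log 2 ≤ x := Real.log_le_log two_pos hn2
  have hln2 := Real.log_two_gt_d9
  have hln2' := Real.log_two_lt_d9
  have hx0 : 0 < x := by linarith
  have hpow : x ^ (3 / 2 : ℝ) = x * √x := by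
    rw [Real.sqrt_eq_rpow, ← Real.rpow_one_add' hx0.le (by norm_num)]
    norm_num
  -- With `s = v / n` and `l ≥ 2v`, `n s² - s l ≤ log n - 2 log n = -log n`. Moreover `l log n` is
  -- of order `v x = √n log^{3/2} n`.
  set v : ℝ := √(n * x) with hv
  have hvv : v = √n * √x := Real.sqrt_mul hn0.le x
  have hv1 : 1 ≤ v := by
    rw [hv, Real.one_le_sqrt]
    nlinarith
  have hvsq : v ^ 2 = n * x := Real.sq_sqrt (by positivity)
  set l : ℕ := ⌈2 * v⌉₊ with hl
  have hl1 : 2 * v ≤ l := Nat.le_ceil _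
  have hl2 : (l : ℝ) ≤ 4 * v := by
    have := (Nat.ceil_lt_add_one (by positivity : 0 ≤ 2 * v)).le
    linarith
  refine ⟨v / n, by positivity, l, fun M hM hMK => ?_⟩
  have hM1 : (1 : ℝ) ≤ M := by exact_mod_cast hM
  have hexp : Real.exp (n * (v / n) ^ 2 - v / n * l) ≤ 1 / n := by
    have : n * (v / n) ^ 2 - v / n * l ≤ -x := by
      have h1 : n * (v / n) ^ 2 = x := by
        rw [div_pow, hvsq]
        field_simp
      have h2 : v / n * (2 * v) = 2 * x := by
        have : v / n * (2 * v) = 2 * v ^ 2 / n := by ring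
        rw [this, hvsq]
        field_simp
      have h3 : v / n * (2 * v) ≤ v / n * l := mul_le_mul_of_nonneg_left hl1 (by positivity)
      linarith
    calc _ ≤ Real.exp (-x) := Real.exp_le_exp.2 this
      _ = 1 / n := by rw [Real.exp_neg, hx, Real.exp_log hn0, one_div]
  have hlogM : Real.log M ≤ n * c + Real.log D := by
    have : (M : ℝ) ≤ (K : ℝ) ^ n * D := by
      have h : (M : ℝ) ≤ (K : ℝ) ^ n / (1 - ε) := (le_div_iff₀ hε).2 hMK
      refine h.trans ?_
      rw [hD, mul_div_assoc']
      gcongr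
      nlinarith [pow_pos (by exact_mod_cast hK : (0 : ℝ) < K) n]
    have hKpos : (0 : ℝ) < K := by exact_mod_cast hK
    calc Real.log M ≤ Real.log ((K : ℝ) ^ n * D) := Real.log_le_log (by positivity) this
      _ = _ := by rw [Real.log_mul (by positivity) (by positivity), Real.log_pow]
  have hlogM0 : 0 ≤ Real.log M := Real.log_nonneg hM1
  have hterm : Real.exp (n * (v / n) ^ 2 - v / n * l) * D * Real.log M ≤ D * (c + Real.log D) := by
    calc _ ≤ 1 / n * D * (n * c + Real.log D) := by gcongr
      _ = D * (c + Real.log D / n) := by field_simp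
      _ ≤ _ := by
        gcongr
        exact div_le_self hlogD (by linarith)
  have hKpos : (0 : ℝ) < K := by exact_mod_cast hK
  rw [Real.log_mul (by positivity) (by positivity), Real.log_pow,
    Real.log_mul (by positivity) (by positivity), ← hc, ← hx, hpow]
  have hlen : (l : ℝ) * (x + c) ≤ 4 * (1 + 2 * c) * (v * x) := by
    calc (l : ℝ) * (x + c) ≤ 4 * v * (x + 2 * c * x) := by
          gcongr
          nlinarith
      _ = _ := by ring
  -- Constants are absorbed using `v ≥ 1` and `x ≥ log 2 > 1/2`, which is where `n ≥ 2` matters.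
  have hconst : R ≤ 2 * R * (v * x) := by
    have : 1 ≤ 2 * (v * x) := by nlinarith
    nlinarith
  have : (4 * (1 + 2 * c) + 2 * R) * √n * (x * √x) = 4 * (1 + 2 * c) * (v * x)
      + 2 * R * (v * x) := by rw [hvv]; ring
  rw [this]
  linarith

end ListDecoding

/-! ### Divergence and mutual information as finite sums; the saddle point -/

section FiniteAlphabet

lemma klDiv_eq_ofReal_sum {α : Type*} [Fintype α] [MeasurableSpace α] [MeasurableSingletonClass α]
    (μ ν : Measure α) [IsProbabilityMeasure μ] [IsProbabilityMeasure ν]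
    (h : ∀ a, ν.real {a} = 0 → μ.real {a} = 0) :
    klDiv μ ν = ENNReal.ofReal (∑ a, μ.real {a} * Real.log (μ.real {a} / ν.real {a})) := by
  have hac : μ ≪ ν := by
    intro s hs
    rw [← Set.biUnion_of_singleton s, measure_biUnion_null_iff s.to_countable]
    intro a ha
    have : ν {a} = 0 := measure_mono_null (by simpa using ha) hs
    have := h a (by simp [Measure.real, this])
    simpa [Measure.real, ENNReal.toReal_eq_zero_iff] using this
  rw [klDiv_of_ac_of_integrable hac .of_finite, integral_fintype .of_finite]
  simp only [probReal_univ, add_sub_cancel_right, smul_eq_mul]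
  congr 1
  refine Finset.sum_congr rfl fun a _ => ?_
  by_cases ha : ν.real {a} = 0
  · simp [h a ha]
  · rw [llr]
    congr 2
    have h1 := Measure.setLIntegral_rnDeriv hac {a}
    rw [lintegral_singleton] at h1
    rw [eq_div_iff ha, Measure.real, Measure.real, ← ENNReal.toReal_mul, h1]

lemma real_singleton_mem_stdSimplex {α : Type*} [Fintype α] [MeasurableSpace α]
    [MeasurableSingletonClass α] (μ : Measure α) [IsProbabilityMeasure μ] :
    (fun a => μ.real {a}) ∈ stdSimplex ℝ α :=
  ⟨fun _ => measureReal_nonneg, by simp⟩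

lemma exists_probabilityMeasure_real_singleton {α : Type*} [Fintype α] [MeasurableSpace α]
    [MeasurableSingletonClass α] {r : α → ℝ} (hr : r ∈ stdSimplex ℝ α) :
    ∃ p : ProbabilityMeasure α, ∀ a, (p : Measure α).real {a} = r a := by
  classical
  set μ : Measure α := ∑ a, ENNReal.ofReal (r a) • Measure.dirac a with hμ
  have hμa (a : α) : μ {a} = ENNReal.ofReal (r a) := by
    simp [hμ, Set.indicator_apply, Finset.sum_ite_eq']
  have : IsProbabilityMeasure μ := ⟨by
    simp [hμ, ← ENNReal.ofReal_sum_of_nonneg fun a _ => hr.1 a, hr.2]⟩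
  exact ⟨⟨μ, this⟩, fun a => by
    simp [Measure.real, hμa, ENNReal.toReal_ofReal (hr.1 a)]⟩

variable {X Y : Type*} [Fintype X] [Fintype Y]

/-- The output weights induced by the input weights `p` and the stochastic matrix `W`. -/
noncomputable def outputWeights (W : X → Y → ℝ) (p : X → ℝ) (y : Y) : ℝ := ∑ x, p x * W x y

/-- Mutual information of a finite channel, as output entropy minus conditional entropy. -/
noncomputable def entropyGap (W : X → Y → ℝ) (p : X → ℝ) : ℝ :=
  ∑ x, p x * ∑ y, W x y * Real.log (W x y)
    - ∑ y, outputWeights W p y * Real.log (outputWeights W p y)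

variable {W : X → Y → ℝ} {p r : X → ℝ}

lemma outputWeights_mem_stdSimplex (hW : ∀ x, W x ∈ stdSimplex ℝ Y) (hp : p ∈ stdSimplex ℝ X) :
    outputWeights W p ∈ stdSimplex ℝ Y := by
  refine ⟨fun y => Finset.sum_nonneg fun x _ => mul_nonneg (hp.1 x) ((hW x).1 y), ?_⟩
  simp only [outputWeights]
  rw [Finset.sum_comm]
  simp [← Finset.mul_sum, (hW _).2, hp.2]

lemma mul_eq_zero_of_outputWeights_eq_zero (hW : ∀ x, W x ∈ stdSimplex ℝ Y)
    (hp : p ∈ stdSimplex ℝ X) {y : Y} (hy : outputWeights W p y = 0) (x : X) :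
    p x * W x y = 0 :=
  (Finset.sum_eq_zero_iff_of_nonneg fun x _ => mul_nonneg (hp.1 x) ((hW x).1 y)).1 hy x
    (Finset.mem_univ x)

lemma sum_mul_log_div_eq (hW : ∀ x, W x ∈ stdSimplex ℝ Y) (hr : r ∈ stdSimplex ℝ X)
    {q : Y → ℝ} (hq : ∀ y, q y = 0 → outputWeights W r y = 0) :
    ∑ x, r x * ∑ y, W x y * Real.log (W x y / q y) =
      ∑ x, r x * ∑ y, W x y * Real.log (W x y) - ∑ y, outputWeights W r y * Real.log (q y) := by
  simp only [outputWeights, Finset.sum_mul, Finset.mul_sum]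
  rw [Finset.sum_comm (s := (Finset.univ : Finset Y)), ← Finset.sum_sub_distrib]
  refine Finset.sum_congr rfl fun x _ => ?_
  rw [← Finset.sum_sub_distrib]
  refine Finset.sum_congr rfl fun y _ => ?_
  by_cases h : r x * W x y = 0
  · simp only [← mul_assoc, h, zero_mul, sub_zero]
  · have hq0 : q y ≠ 0 := fun h0 =>
      h (mul_eq_zero_of_outputWeights_eq_zero hW hr (hq y h0) x)
    rw [Real.log_div (right_ne_zero_of_mul h) hq0]
    ring

/-- Gibbs' inequality. Absolute continuity is essential, since `Real.log 0 = 0` would hide an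
infinite divergence. -/
lemma mul_log_le_mul_log_of_stdSimplex {q q' : Y → ℝ} (hq : q ∈ stdSimplex ℝ Y)
    (hq' : q' ∈ stdSimplex ℝ Y) (h : ∀ y, q' y = 0 → q y = 0) :
    ∑ y, q y * Real.log (q' y) ≤ ∑ y, q y * Real.log (q y) := by
  have : ∑ y, (q y - q' y) ≤ ∑ y, (q y * Real.log (q y) - q y * Real.log (q' y)) := by
    refine Finset.sum_le_sum fun y _ => ?_
    rcases (hq'.1 y).eq_or_lt with h0 | h0
    · simp [← h0, h y h0.symm]
    · have := sub_le_mul_log_div (hq.1 y) (Or.inl h0)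
      rcases eq_or_ne (q y) 0 with h1 | h1
      · simp [h1, h0.le]
      · rwa [Real.log_div h1 h0.ne', mul_sub] at this
  rw [Finset.sum_sub_distrib, Finset.sum_sub_distrib, hq.2, hq'.2] at this
  linarith

/-- If moving from `p` towards `r` does not increase the mutual information, then the output of
`r` is absolutely continuous with respect to that of `p`, and the conditional divergence of the
channel from the output of `p`, averaged over `r`, is at most the mutual information of `p`. -/
lemma sum_mul_log_div_le_entropyGap (hW : ∀ x, W x ∈ stdSimplex ℝ Y) (hp : p ∈ stdSimplex ℝ X)
    (hr : r ∈ stdSimplex ℝ X)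
    (hmax : ∀ t ∈ Set.Ioo (0 : ℝ) 1, entropyGap W ((1 - t) • p + t • r) ≤ entropyGap W p) :
    (∀ y, outputWeights W p y = 0 → outputWeights W r y = 0) ∧
      ∑ x, r x * ∑ y, W x y * Real.log (W x y / outputWeights W p y) ≤ entropyGap W p := by
  classical
  set q := outputWeights W p with hq
  set q' := outputWeights W r with hq'
  have hqs := outputWeights_mem_stdSimplex hW hp
  have hqs' := outputWeights_mem_stdSimplex hW hr
  rw [← hq] at hqs
  rw [← hq'] at hqs'
  set H := ∑ x, r x * ∑ y, W x y * Real.log (W x y) with hH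
  have hlin (t : ℝ) (y : Y) : outputWeights W ((1 - t) • p + t • r) y
      = (1 - t) * q y + t * q' y := by
    simp only [hq, hq', outputWeights, Pi.add_apply, Pi.smul_apply, smul_eq_mul, Finset.mul_sum,
      ← Finset.sum_add_distrib]
    exact Finset.sum_congr rfl fun x _ => by ring
  have hmix (t : ℝ) (ht : t ∈ Set.Ioo (0 : ℝ) 1) :
      (fun y => (1 - t) * q y + t * q' y) ∈ stdSimplex ℝ Y := by
    refine ⟨fun y => add_nonneg (mul_nonneg (by linarith [ht.2]) (hqs.1 y))
      (mul_nonneg ht.1.le (hqs'.1 y)), ?_⟩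
    rw [Finset.sum_add_distrib, ← Finset.mul_sum, ← Finset.mul_sum, hqs.2, hqs'.2]
    ring
  -- The mutual information of the mixture splits into a `p`-part and an `r`-part, both relative to
  -- the mixed output law. By Gibbs the `p`-part is at least `entropyGap W p`, so maximality forces
  -- the `r`-part below it.
  have hkey (t : ℝ) (ht : t ∈ Set.Ioo (0 : ℝ) 1) :
      H - ∑ y, q' y * Real.log ((1 - t) * q y + t * q' y) ≤ entropyGap W p := by
    have h1 := hmax t ht
    have hG := mul_log_le_mul_log_of_stdSimplex hqs (hmix t ht) fun y hy => by
      have h2 := mul_nonneg (by linarith [ht.2] : 0 ≤ 1 - t) (hqs.1 y)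
      have h3 := mul_nonneg ht.1.le (hqs'.1 y)
      have : (1 - t) * q y = 0 := by linarith
      exact (mul_eq_zero.1 this).resolve_left (by linarith [ht.2])
    have hsplit : entropyGap W ((1 - t) • p + t • r) =
        (1 - t) * (∑ x, p x * ∑ y, W x y * Real.log (W x y)
          - ∑ y, q y * Real.log ((1 - t) * q y + t * q' y))
        + t * (H - ∑ y, q' y * Real.log ((1 - t) * q y + t * q' y)) := by
      simp only [entropyGap, hlin, Pi.add_apply, Pi.smul_apply, smul_eq_mul, add_mul,
        Finset.sum_add_distrib, mul_assoc, ← Finset.mul_sum]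
      ring
    have hgap : entropyGap W p ≤ ∑ x, p x * ∑ y, W x y * Real.log (W x y)
          - ∑ y, q y * Real.log ((1 - t) * q y + t * q' y) := by
      rw [entropyGap]
      linarith
    rw [hsplit] at h1
    have := mul_le_mul_of_nonneg_left hgap (by linarith [ht.2] : 0 ≤ 1 - t)
    have h2 : t * (H - ∑ y, q' y * Real.log ((1 - t) * q y + t * q' y)) ≤ t * entropyGap W p := by
      linarith
    exact le_of_mul_le_mul_left h2 ht.1
  have hIoo : ∀ᶠ t in 𝓝[>] (0 : ℝ), t ∈ Set.Ioo (0 : ℝ) 1 := Ioo_mem_nhdsGT one_pos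
  -- If `r` charged an output letter that `p` misses, the term `-q' y log (t q' y)` would tend to
  -- infinity as `t → 0`.
  have hac : ∀ y, q y = 0 → q' y = 0 := by
    intro y hy
    by_contra hne
    have hpos : 0 < q' y := (hqs'.1 y).lt_of_ne' hne
    have hbound : ∀ᶠ t in 𝓝[>] (0 : ℝ), H - entropyGap W p ≤ q' y * Real.log (t * q' y) := by
      filter_upwards [hIoo] with t ht
      have h1 := hkey t ht
      have h2 : ∑ z, q' z * Real.log ((1 - t) * q z + t * q' z) ≤
          q' y * Real.log ((1 - t) * q y + t * q' y) := by
        rw [← Finset.add_sum_erase _ _ (Finset.mem_univ y)]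
        refine add_le_of_nonpos_right (Finset.sum_nonpos fun z _ => ?_)
        refine mul_nonpos_of_nonneg_of_nonpos (hqs'.1 z)
          (Real.log_nonpos ((hmix t ht).1 z) ?_)
        refine le_of_le_of_eq ?_ (hmix t ht).2
        exact Finset.single_le_sum (f := fun y => (1 - t) * q y + t * q' y)
          (fun z _ => (hmix t ht).1 z) (Finset.mem_univ z)
      rw [hy, mul_zero, zero_add] at h2
      linarith
    have htend : Tendsto (fun t : ℝ => q' y * Real.log (t * q' y)) (𝓝[>] 0) atBot := by
      refine Tendsto.const_mul_atBot hpos (Real.tendsto_log_nhdsGT_zero.comp ?_)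
      refine tendsto_nhdsWithin_iff.2 ⟨?_, ?_⟩
      · have : Tendsto (fun t : ℝ => t * q' y) (𝓝 0) (𝓝 (0 * q' y)) :=
          (continuous_id.mul continuous_const).tendsto 0
        rw [zero_mul] at this
        exact this.mono_left nhdsWithin_le_nhds
      · filter_upwards [self_mem_nhdsWithin] with t ht
        exact mul_pos ht hpos
    obtain ⟨t, h1, h2⟩ := (hbound.and (htend.eventually_lt_atBot (H - entropyGap W p))).exists
    linarith
  refine ⟨hac, ?_⟩
  rw [sum_mul_log_div_eq hW hr hac]
  have htend : Tendsto (fun t : ℝ => H - ∑ y, q' y * Real.log ((1 - t) * q y + t * q' y))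
      (𝓝[>] 0) (𝓝 (H - ∑ y, q' y * Real.log (q y))) := by
    refine Tendsto.mono_left (Tendsto.const_sub _ (tendsto_finsetSum _ fun y _ => ?_))
      nhdsWithin_le_nhds
    rcases eq_or_ne (q y) 0 with h0 | h0
    · simp [hac y h0]
    · have : ContinuousAt (fun t : ℝ => q' y * Real.log ((1 - t) * q y + t * q' y)) 0 := by
        refine continuousAt_const.mul (ContinuousAt.log (by fun_prop) (by simpa using h0))
      simpa [ContinuousAt] using this
  exact le_of_tendsto htend (hIoo.mono hkey)

variable [MeasurableSpace X] [MeasurableSingletonClass X] [MeasurableSpace Y]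
  [MeasurableSingletonClass Y]

lemma comp_real_singleton {Y : Type*} [MeasurableSpace Y] [MeasurableSingletonClass Y] (W : Kernel X Y) [IsMarkovKernel W] (p : Measure X)
    [IsProbabilityMeasure p] (y : Y) :
    (W ∘ₘ p).real {y} =
      outputWeights (fun x y => (W x).real {y}) (fun x => p.real {x}) y := by
  rw [Measure.real, Measure.bind_apply (measurableSet_singleton y) W.aemeasurable,
    lintegral_fintype, ENNReal.toReal_sum fun x _ => by finiteness]
  simp [outputWeights, Measure.real, mul_comm]

lemma mutualInfo_eq_ofReal (W : Kernel X Y) [IsMarkovKernel W] (p : ProbabilityMeasure X) :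
    mutualInfo W p = ENNReal.ofReal
      (entropyGap (fun x y => (W x).real {y}) (fun x => (p : Measure X).real {x})) := by
  set w : X → Y → ℝ := fun x y => (W x).real {y} with hw
  set u : X → ℝ := fun x => (p : Measure X).real {x} with hu
  have hws (x : X) : w x ∈ stdSimplex ℝ Y := real_singleton_mem_stdSimplex (W x)
  have hus : u ∈ stdSimplex ℝ X := real_singleton_mem_stdSimplex (p : Measure X)
  have hjoint (x : X) (y : Y) : ((p : Measure X) ⊗ₘ W).real {(x, y)} = u x * w x y := by
    rw [← Set.singleton_prod_singleton, Measure.real,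
      Measure.compProd_apply_prod (measurableSet_singleton x) (measurableSet_singleton y),
      lintegral_singleton]
    simp [hu, hw, Measure.real, mul_comm]
  have hprod (x : X) (y : Y) : ((p : Measure X).prod (W ∘ₘ (p : Measure X))).real {(x, y)}
      = u x * outputWeights w u y := by
    rw [← Set.singleton_prod_singleton, measureReal_prod_prod, comp_real_singleton]
  rw [mutualInfo, klDiv_eq_ofReal_sum]
  · congr 1
    rw [entropyGap, ← sum_mul_log_div_eq hws hus fun y h => h, Fintype.sum_prod_type]
    refine Finset.sum_congr rfl fun x _ => ?_
    rw [Finset.mul_sum]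
    refine Finset.sum_congr rfl fun y _ => ?_
    rw [hjoint, hprod]
    rcases eq_or_ne (u x) 0 with h | h
    · simp [h]
    · rw [mul_div_mul_left _ _ h, mul_assoc]
  · rintro ⟨x, y⟩ h
    rw [hprod] at h
    rw [hjoint]
    rcases mul_eq_zero.1 h with h | h
    · simp [h]
    · exact mul_eq_zero_of_outputWeights_eq_zero hws hus h x

/-- The input weights that satisfy the constraint. -/
def inputWeights (κ : InputConstraint X) : Set (X → ℝ) :=
  match κ with
  | none => Set.univ
  | some (c, P) => {r | ∑ x, r x * c x ≤ P}

lemma mem_inputLaws_iff (κ : InputConstraint X) (p : ProbabilityMeasure X) :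
    p ∈ inputLaws κ ↔ (fun x => (p : Measure X).real {x}) ∈ inputWeights κ := by
  rcases κ with _ | ⟨c, P⟩
  · simp [inputLaws, inputWeights]
  · simp [inputLaws, inputWeights, integral_fintype (μ := (p : Measure X)) (f := c) .of_finite]

lemma convex_inputWeights {X : Type*} [Fintype X] (κ : InputConstraint X) :
    Convex ℝ (inputWeights κ) := by
  rcases κ with _ | ⟨c, P⟩
  · exact convex_univ
  · intro p hp r hr a b ha hb hab
    change ∑ x, _ ≤ P
    change ∑ x, p x * c x ≤ P at hp
    change ∑ x, r x * c x ≤ P at hr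
    simp only [Pi.add_apply, Pi.smul_apply, smul_eq_mul, add_mul, Finset.sum_add_distrib,
      mul_assoc, ← Finset.mul_sum]
    calc _ ≤ a * P + b * P := by gcongr
      _ = P := by rw [← add_mul, hab, one_mul]

/-- The saddle-point property of the capacity-achieving output distribution. -/
lemma IsCaod.sum_mul_log_div_le {W : Kernel X Y} [IsMarkovKernel W] {κ : InputConstraint X}
    {Q : Measure Y} (hQ : IsCaod W κ Q) (hC : 0 < capacity W κ) {r : X → ℝ}
    (hr : r ∈ stdSimplex ℝ X) (hrκ : r ∈ inputWeights κ) :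
    (∀ x y, Q.real {y} = 0 → r x ≠ 0 → (W x).real {y} = 0) ∧
      ∑ x, r x * ∑ y, (W x).real {y} * Real.log ((W x).real {y} / Q.real {y})
        ≤ capacity W κ := by
  obtain ⟨p, hp, hmax, rfl⟩ := hQ
  set w : X → Y → ℝ := fun x y => (W x).real {y} with hw
  have hws (x : X) : w x ∈ stdSimplex ℝ Y := real_singleton_mem_stdSimplex (W x)
  set u : X → ℝ := fun x => (p : Measure X).real {x} with hu
  have hus : u ∈ stdSimplex ℝ X := real_singleton_mem_stdSimplex (p : Measure X)
  have hsup : ⨆ p' ∈ inputLaws κ, mutualInfo W p' = mutualInfo W p :=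
    le_antisymm (iSup₂_le hmax) (le_iSup₂_of_le p hp le_rfl)
  have hcap : capacity W κ = (ENNReal.ofReal (entropyGap w u)).toReal := by
    rw [capacity, hsup, mutualInfo_eq_ofReal]
  -- Positivity lets comparisons pass through the truncation in `ENNReal.ofReal`.
  have hpos : 0 < entropyGap w u := by
    by_contra h
    rw [hcap, ENNReal.ofReal_of_nonpos (not_lt.1 h)] at hC
    simp at hC
  rw [hcap, ENNReal.toReal_ofReal hpos.le]
  have hkkt := sum_mul_log_div_le_entropyGap hws hus hr fun t ht => by
    have hmem : (1 - t) • u + t • r ∈ stdSimplex ℝ X :=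
      convex_stdSimplex ℝ X hus hr (by linarith [ht.2]) ht.1.le (by ring)
    obtain ⟨p', hp'⟩ := exists_probabilityMeasure_real_singleton hmem
    have hp'eq : (fun x => (p' : Measure X).real {x}) = (1 - t) • u + t • r := funext hp'
    have hle := hmax p' (by
      rw [mem_inputLaws_iff, hp'eq]
      exact convex_inputWeights κ ((mem_inputLaws_iff κ p).1 hp) hrκ
        (by linarith [ht.2]) ht.1.le (by ring))
    rw [mutualInfo_eq_ofReal, mutualInfo_eq_ofReal, hp'eq] at hle
    exact (ENNReal.ofReal_le_ofReal_iff hpos.le).1 hle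
  simp only [comp_real_singleton]
  refine ⟨fun x y hy hx => ?_, hkkt.2⟩
  exact (mul_eq_zero.1 (mul_eq_zero_of_outputWeights_eq_zero hws hr (hkkt.1 y hy) x)).resolve_left
    hx

end FiniteAlphabet

/-! ### Additivity of divergence over product laws -/

section Tensorization

variable {Y : Type*} [Fintype Y]

lemma sum_prod_mul_apply {n : ℕ} {w : Fin n → Y → ℝ} (hw : ∀ j, w j ∈ stdSimplex ℝ Y)
    (g : Y → ℝ) (j : Fin n) :
    ∑ y : Fin n → Y, (∏ i, w i (y i)) * g (y j) = ∑ a, w j a * g a := by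
  classical
  calc ∑ y : Fin n → Y, (∏ i, w i (y i)) * g (y j)
      = ∑ y : Fin n → Y, ∏ i, w i (y i) * (if i = j then g (y i) else 1) := by
        refine Finset.sum_congr rfl fun y _ => ?_
        rw [Finset.prod_mul_distrib]
        simp
    _ = ∏ i, ∑ a, w i a * (if i = j then g a else 1) := by
        rw [Finset.prod_univ_sum, Fintype.piFinset_univ]
    _ = ∏ i, if i = j then ∑ a, w j a * g a else 1 := by
        refine Finset.prod_congr rfl fun i _ => ?_
        split_ifs with h
        · rw [h]
        · simpa using (hw i).2
    _ = _ := by simp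

lemma sum_prod_mul_log_div {n : ℕ} {w q : Fin n → Y → ℝ} (hw : ∀ j, w j ∈ stdSimplex ℝ Y)
    (hac : ∀ j a, q j a = 0 → w j a = 0) :
    ∑ y : Fin n → Y, (∏ j, w j (y j)) * Real.log ((∏ j, w j (y j)) / ∏ j, q j (y j)) =
      ∑ j, ∑ a, w j a * Real.log (w j a / q j a) := by
  calc _ = ∑ y : Fin n → Y, ∑ j, (∏ i, w i (y i)) * Real.log (w j (y j) / q j (y j)) := by
        refine Finset.sum_congr rfl fun y _ => ?_
        by_cases h : ∏ j, w j (y j) = 0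
        · simp [h]
        · have hne (j : Fin n) : w j (y j) ≠ 0 := Finset.prod_ne_zero_iff.1 h j (Finset.mem_univ j)
          rw [← Finset.prod_div_distrib, Real.log_prod, Finset.mul_sum]
          exact fun j _ => div_ne_zero (hne j) fun h0 => hne j (hac j _ h0)
    _ = _ := by
        rw [Finset.sum_comm]
        exact Finset.sum_congr rfl fun j _ =>
          sum_prod_mul_apply hw (fun a => Real.log (w j a / q j a)) j

end Tensorization

lemma sum_mul_log_div_nonneg {Ω : Type*} [Fintype Ω] {p q : Ω → ℝ} (hp : p ∈ stdSimplex ℝ Ω)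
    (hq : q ∈ stdSimplex ℝ Ω) (hac : ∀ y, q y = 0 → p y = 0) :
    0 ≤ ∑ y, p y * Real.log (p y / q y) := by
  have : ∑ y, (p y - q y) ≤ ∑ y, p y * Real.log (p y / q y) :=
    Finset.sum_le_sum fun y _ => sub_le_mul_log_div (hp.1 y) <|
      (hq.1 y).eq_or_lt.symm.imp id fun h => ⟨hac y h.symm, hq.1 y⟩
  rwa [Finset.sum_sub_distrib, hp.2, hq.2, sub_self] at this

/-! ### Output laws of codes -/

section Codes

variable {X Y : Type*} [MeasurableSpace X] [MeasurableSpace Y] {W : Kernel X Y}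
  [IsMarkovKernel W] {κ : InputConstraint X} {n M : ℕ} {ε : ℝ}

lemma wordLaw_real_singleton (W : Kernel X Y) [IsMarkovKernel W] (x : Fin n → X) (y : Fin n → Y) :
    (wordLaw W x).real {y} = ∏ j, (W (x j)).real {y j} := by
  simp [wordLaw, Measure.real, Measure.pi_singleton, ENNReal.toReal_prod]

lemma powerLaw_real_singleton (Q : Measure Y) [IsProbabilityMeasure Q] (y : Fin n → Y) :
    (powerLaw Q n).real {y} = ∏ j, Q.real {y j} := by
  simp [powerLaw, Measure.real, Measure.pi_singleton, ENNReal.toReal_prod]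

instance (W : Kernel X Y) [IsMarkovKernel W] (x : Fin n → X) : IsProbabilityMeasure (wordLaw W x) := by
  unfold wordLaw
  infer_instance

instance (Q : Measure Y) [IsProbabilityMeasure Q] (n : ℕ) :
    IsProbabilityMeasure (powerLaw Q n) := by
  unfold powerLaw
  infer_instance

lemma MaxDetCode.isProbabilityMeasure_outputLaw (𝒞 : MaxDetCode W κ n M ε) : IsProbabilityMeasure 𝒞.outputLaw := ⟨by
  have hM : (M : ℝ≥0∞) ≠ 0 := by exact_mod_cast 𝒞.pos.ne'
  simp [MaxDetCode.outputLaw, ENNReal.inv_mul_cancel hM]⟩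

lemma MaxDetCode.outputLaw_real_singleton (𝒞 : MaxDetCode W κ n M ε) (y : Fin n → Y) :
    𝒞.outputLaw.real {y} = (M : ℝ)⁻¹ * ∑ i, ∏ j, (W (𝒞.enc i j)).real {y j} := by
  simp only [← wordLaw_real_singleton]
  simp only [MaxDetCode.outputLaw, Measure.real, Measure.smul_apply, Measure.coe_finsetSum,
    Finset.sum_apply, smul_eq_mul, ENNReal.toReal_mul, ENNReal.toReal_inv, ENNReal.toReal_natCast]
  rw [ENNReal.toReal_sum fun i _ => by finiteness]

variable [Fintype Y] [MeasurableSingletonClass Y]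

lemma MaxDetCode.one_sub_le_correct (𝒞 : MaxDetCode W κ n M ε) (hε0 : 0 ≤ ε) (i : Fin M) :
    1 - ε ≤ ∑ y, (∏ j, (W (𝒞.enc i j)).real {y j}) * (𝒞.dec y).real {i} := by
  have := 𝒞.isMarkovKernel_dec
  have h1 : (𝒞.dec ∘ₘ wordLaw W (𝒞.enc i)).real {i}ᶜ ≤ ε :=
    ENNReal.toReal_le_of_le_ofReal hε0 (𝒞.error_le i)
  rw [probReal_compl_eq_one_sub (measurableSet_singleton i), comp_real_singleton] at h1
  simp only [outputWeights, wordLaw_real_singleton] at h1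
  linarith

variable [Fintype X] [MeasurableSingletonClass X] {Q : Measure Y}

/-- The conditional divergence from the capacity-achieving output distribution is at most `n C`
for every admissible word. -/
lemma IsCaod.sum_word_le (hQ : IsCaod W κ Q) (hC : 0 < capacity W κ) (hn : 0 < n)
    {x : Fin n → X} (hx : x ∈ inputSpace κ n) :
    (∀ j y, Q.real {y} = 0 → (W (x j)).real {y} = 0) ∧
      ∑ j, ∑ y, (W (x j)).real {y} * Real.log ((W (x j)).real {y} / Q.real {y})
        ≤ n * capacity W κ := by
  classical
  have hn0 : (0 : ℝ) < n := by exact_mod_cast hn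
  -- The empirical distribution of the word: it inherits the cost constraint and charges every
  -- letter that occurs.
  set r : X → ℝ := fun a => (n : ℝ)⁻¹ * ∑ j, if x j = a then 1 else 0 with hr
  have hsum (g : X → ℝ) : ∑ a, r a * g a = (n : ℝ)⁻¹ * ∑ j, g (x j) := by
    simp only [hr, mul_assoc, ← Finset.mul_sum, Finset.sum_mul]
    rw [Finset.sum_comm]
    simp
  have hrs : r ∈ stdSimplex ℝ X := by
    refine ⟨fun a => mul_nonneg (by positivity)
      (Finset.sum_nonneg fun j _ => by split_ifs <;> norm_num), ?_⟩
    have := hsum fun _ => 1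
    simp only [mul_one, Finset.sum_const, Finset.card_univ, Fintype.card_fin, nsmul_eq_mul] at this
    rw [this]
    field_simp
  have hrκ : r ∈ inputWeights κ := by
    rcases κ with _ | ⟨c, P⟩
    · exact Set.mem_univ r
    · change ∑ a, r a * c a ≤ P
      change ∑ j, c (x j) ≤ n * P at hx
      rw [hsum, inv_mul_le_iff₀ hn0]
      exact hx
  obtain ⟨hac, hle⟩ := hQ.sum_mul_log_div_le hC hrs hrκ
  refine ⟨fun j y hy => hac (x j) y hy ?_, ?_⟩
  · refine (mul_pos (by positivity) ?_).ne'
    exact Finset.sum_pos' (fun i _ => by split_ifs <;> norm_num) ⟨j, Finset.mem_univ j, by simp⟩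
  · rwa [hsum, inv_mul_le_iff₀ hn0] at hle

/-- The compensation identity, with each `D(P_i ‖ Qⁿ)` bounded by `nC`. Nonnegativity of the bound
is recorded because `ENNReal.ofReal` alone would not yield the comparison in `EReal`. -/
lemma MaxDetCode.klDiv_outputLaw_le (hQ : IsCaod W κ Q) (hC : 0 < capacity W κ) (hn : 0 < n)
    (𝒞 : MaxDetCode W κ n M ε) {I : ℝ}
    (hI : I ≤ (M : ℝ)⁻¹ * ∑ i, ∑ y : Fin n → Y, (∏ j, (W (𝒞.enc i j)).real {y j}) *
      Real.log ((∏ j, (W (𝒞.enc i j)).real {y j}) / 𝒞.outputLaw.real {y})) :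
    0 ≤ n * capacity W κ - I ∧
      klDiv 𝒞.outputLaw (powerLaw Q n) ≤ ENNReal.ofReal (n * capacity W κ - I) := by
  have hM : (0 : ℝ) < M := by exact_mod_cast 𝒞.pos
  have hQp : IsProbabilityMeasure Q := by
    obtain ⟨p, -, -, rfl⟩ := hQ
    infer_instance
  have := 𝒞.isProbabilityMeasure_outputLaw
  set P : Fin M → (Fin n → Y) → ℝ := fun i y => ∏ j, (W (𝒞.enc i j)).real {y j} with hP
  have hw (i : Fin M) (j : Fin n) : (fun a => (W (𝒞.enc i j)).real {a}) ∈ stdSimplex ℝ Y :=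
    real_singleton_mem_stdSimplex _
  have hP0 (i : Fin M) (y : Fin n → Y) : 0 ≤ P i y := prod_nonneg_of_stdSimplex (hw i) y
  set q : (Fin n → Y) → ℝ := fun y => ∏ j, Q.real {y j} with hq
  set o : (Fin n → Y) → ℝ := fun y => 𝒞.outputLaw.real {y} with ho
  have ho_eq (y : Fin n → Y) : o y = (M : ℝ)⁻¹ * ∑ i, P i y := 𝒞.outputLaw_real_singleton y
  have hword (i : Fin M) := hQ.sum_word_le hC hn (𝒞.enc_mem i)
  have hPq (i : Fin M) (y : Fin n → Y) (hy : q y = 0) : P i y = 0 := by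
    obtain ⟨j, -, hj⟩ := Finset.prod_eq_zero_iff.1 hy
    exact Finset.prod_eq_zero (Finset.mem_univ j) ((hword i).1 j _ hj)
  have hPo (i : Fin M) (y : Fin n → Y) (hy : o y = 0) : P i y = 0 := by
    rw [ho_eq, mul_eq_zero, Finset.sum_eq_zero_iff_of_nonneg fun i _ => hP0 i y] at hy
    exact hy.resolve_left (by positivity) i (Finset.mem_univ i)
  have hoq (y : Fin n → Y) (hy : q y = 0) : o y = 0 := by
    rw [ho_eq, Finset.sum_eq_zero fun i _ => hPq i y hy, mul_zero]
  have hqs : q ∈ stdSimplex ℝ (Fin n → Y) := by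
    have := real_singleton_mem_stdSimplex (powerLaw Q n)
    simpa only [powerLaw_real_singleton] using this
  have hkl : klDiv 𝒞.outputLaw (powerLaw Q n)
      = ENNReal.ofReal (∑ y, o y * Real.log (o y / q y)) := by
    rw [klDiv_eq_ofReal_sum]
    · simp only [powerLaw_real_singleton, ho, hq]
    · intro y hy
      rw [powerLaw_real_singleton] at hy
      exact hoq y hy
  have hnonneg := sum_mul_log_div_nonneg
    (real_singleton_mem_stdSimplex 𝒞.outputLaw) hqs hoq
  have hle : ∑ y, o y * Real.log (o y / q y) ≤ n * capacity W κ - I := by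
    calc ∑ y, o y * Real.log (o y / q y)
        = (M : ℝ)⁻¹ * ∑ i, ∑ y, P i y * Real.log (P i y / q y)
          - (M : ℝ)⁻¹ * ∑ i, ∑ y, P i y * Real.log (P i y / o y) := by
          rw [← mul_sub, ← Finset.sum_sub_distrib]
          simp only [← Finset.sum_sub_distrib]
          rw [Finset.sum_comm, Finset.mul_sum]
          refine Finset.sum_congr rfl fun y _ => ?_
          conv_lhs => rw [ho_eq y, mul_assoc, Finset.sum_mul]
          congr 1
          refine Finset.sum_congr rfl fun i _ => ?_
          rw [← ho_eq]
          by_cases h : P i y = 0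
          · simp [h]
          · have h1 : o y ≠ 0 := fun h0 => h (hPo i y h0)
            have h2 : q y ≠ 0 := fun h0 => h (hPq i y h0)
            rw [Real.log_div h h2, Real.log_div h h1, Real.log_div h1 h2]
            ring
      _ ≤ (M : ℝ)⁻¹ * ∑ _i : Fin M, n * capacity W κ - I := by
          refine sub_le_sub (mul_le_mul_of_nonneg_left
            (Finset.sum_le_sum fun i _ => ?_) (by positivity)) hI
          rw [sum_prod_mul_log_div (q := fun _ a => Q.real {a}) (hw i) (hword i).1]
          exact (hword i).2
      _ = _ := by
          simp only [Finset.sum_const, Finset.card_univ, Fintype.card_fin, nsmul_eq_mul]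
          field_simp
  exact ⟨hnonneg.trans hle, hkl.trans_le (ENNReal.ofReal_le_ofReal hle)⟩

lemma exists_forall_klDiv_outputLaw_le (hQ : IsCaod W κ Q) (hC : 0 < capacity W κ)
    (hε0 : 0 ≤ ε) (hε1 : ε < 1) :
    ∃ b : ℝ, 0 < b ∧ ∀ n : ℕ, 2 ≤ n → ∀ (M : ℕ) (𝒞 : MaxDetCode W κ n M ε),
      0 ≤ n * capacity W κ - Real.log M + b * √(n : ℝ) * Real.log n ^ (3 / 2 : ℝ) ∧
      klDiv 𝒞.outputLaw (powerLaw Q n) ≤ ENNReal.ofReal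
        (n * capacity W κ - Real.log M + b * √(n : ℝ) * Real.log n ^ (3 / 2 : ℝ)) := by
  have hQp : IsProbabilityMeasure Q := by
    obtain ⟨p, -, -, rfl⟩ := hQ
    infer_instance
  have : Nonempty Y := nonempty_of_isProbabilityMeasure Q
  obtain ⟨b, hb, h⟩ := exists_forall_loss_le (Fintype.card_pos (α := Y)) hε0 hε1
  refine ⟨b, hb, fun n hn M 𝒞 => ?_⟩
  obtain ⟨s, hs, l, hl⟩ := h n hn
  have hn0 : 0 < n := by omega
  have := 𝒞.isMarkovKernel_dec
  have hw (i : Fin M) (j : Fin n) : (fun a => (W (𝒞.enc i j)).real {a}) ∈ stdSimplex ℝ Y :=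
    real_singleton_mem_stdSimplex _
  have hcard := card_mul_le_of_correct
    (fun i => ⟨prod_nonneg_of_stdSimplex (hw i), sum_prod_eq_one (hw i)⟩)
    (fun y => real_singleton_mem_stdSimplex (𝒞.dec y)) (𝒞.one_sub_le_correct hε0)
  rw [Fintype.card_fun, Fintype.card_fin, Nat.cast_pow] at hcard
  have hloss := hl M 𝒞.pos hcard
  have hI := log_le_average_klDiv_of_code hn0 hw 𝒞.pos
    (fun y => real_singleton_mem_stdSimplex (𝒞.dec y)) hε0 hε1 (𝒞.one_sub_le_correct hε0)
    𝒞.outputLaw_real_singleton hs l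
  have := 𝒞.klDiv_outputLaw_le hQ hC hn0
    (I := Real.log M - b * √(n : ℝ) * Real.log n ^ (3 / 2 : ℝ)) (le_trans (by linarith) hI)
  rwa [← sub_add] at this

end Codes

end DMC

/-! ### The divergence bound and its asymptotic consequence -/

theorem mainTheorem3 {X Y : Type*}
    [Fintype X] [MeasurableSpace X] [MeasurableSingletonClass X]
    [Fintype Y] [MeasurableSpace Y] [MeasurableSingletonClass Y]
    (W : Kernel X Y) [IsMarkovKernel W] (κ : DMC.InputConstraint X)
    (hC : 0 < DMC.capacity W κ)
    (Q : Measure Y) (hQ : DMC.IsCaod W κ Q)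
    (ε : ℝ) (hε0 : 0 ≤ ε) (hε1 : ε < 1) :
    (∃ b : ℝ, 0 < b ∧
      ∀ (n : ℕ), 2 ≤ n → ∀ (M : ℕ) (𝒞 : DMC.MaxDetCode W κ n M ε),
        (klDiv 𝒞.outputLaw (DMC.powerLaw Q n) : EReal) ≤
          ((n * DMC.capacity W κ - Real.log M
            + b * √(n : ℝ) * Real.log n ^ (3 / 2 : ℝ) : ℝ) : EReal)) ∧
    (∀ (M : ℕ+ → ℕ) (𝒞 : ∀ n : ℕ+, DMC.MaxDetCode W κ n (M n) ε),
      Tendsto (fun n : ℕ+ => Real.log (M n) / (n : ℕ)) atTop (𝓝 (DMC.capacity W κ)) →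
      Tendsto (fun n : ℕ+ => klDiv (𝒞 n).outputLaw (DMC.powerLaw Q n) / ((n : ℕ) : ℝ≥0∞))
        atTop (𝓝 0)) := by
  obtain ⟨b, hb, h⟩ := DMC.exists_forall_klDiv_outputLaw_le hQ hC hε0 hε1
  refine ⟨⟨b, hb, fun n hn M 𝒞 => ?_⟩, fun M 𝒞 hM => ?_⟩
  · obtain ⟨h0, hle⟩ := h n hn M 𝒞
    refine (EReal.coe_ennreal_le_coe_ennreal_iff.2 hle).trans_eq ?_
    rw [EReal.coe_ennreal_ofReal, max_eq_left h0]
  -- After division by `n` the error term becomes `b log^{3/2} n / √n`, which vanishes; the bound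
  -- holds only from `n = 2` on, hence the eventual comparison.
  · have hrate : Tendsto (fun n : ℕ+ => Real.log (n : ℕ) ^ (3 / 2 : ℝ) / √((n : ℕ) : ℝ)) atTop
        (𝓝 0) := by
      have h1 := (isLittleO_log_rpow_rpow_atTop (3 / 2) (by norm_num : (0 : ℝ) < 1 / 2)
        ).tendsto_div_nhds_zero
      simp only [← Real.sqrt_eq_rpow] at h1
      exact (h1.comp tendsto_natCast_atTop_atTop).comp tendsto_PNat_val_atTop_atTop
    have hlim : Tendsto (fun n : ℕ+ => ENNReal.ofReal (DMC.capacity W κ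
        - Real.log (M n) / (n : ℕ)
        + b * (Real.log (n : ℕ) ^ (3 / 2 : ℝ) / √((n : ℕ) : ℝ)))) atTop (𝓝 0) := by
      have := ENNReal.tendsto_ofReal ((hM.const_sub (DMC.capacity W κ)).add (hrate.const_mul b))
      simpa using this
    refine tendsto_of_tendsto_of_tendsto_of_le_of_le' tendsto_const_nhds hlim
      (Eventually.of_forall fun _ => zero_le) ?_
    filter_upwards [eventually_ge_atTop (2 : ℕ+)] with n hn
    have hn2 : 2 ≤ (n : ℕ) := hn
    have hn0 : (0 : ℝ) < (n : ℕ) := by exact_mod_cast n.pos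
    refine (ENNReal.div_le_div_right (h n hn2 (M n) (𝒞 n)).2 _).trans_eq ?_
    rw [← ENNReal.ofReal_natCast, ← ENNReal.ofReal_div_of_pos hn0]
    congr 1
    have hsq := Real.mul_self_sqrt hn0.le
    have hs0 : √((n : ℕ) : ℝ) ≠ 0 := (Real.sqrt_pos.2 hn0).ne'
    have : √((n : ℕ) : ℝ) / (n : ℕ) = 1 / √((n : ℕ) : ℝ) := by
      rw [div_eq_div_iff hn0.ne' hs0, hsq, one_mul]
    rw [add_div, sub_div, mul_div_cancel_left₀ _ hn0.ne', mul_right_comm, mul_div_assoc, this]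
    ring
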